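/- An overpartition of a nonnegative integer $n$ is a partition of $n$ in which the first occurrence of each distinct part size may be overlined; there is exactly one overpartition of $0$ (the empty one). An overpartition pair of $n$ is an ordered pair $(\lambda,\mu)$ of overpartitions, either of which may be the empty overpartition of $0$, such that the sum of all the parts of $\lambda$ and $\mu$ is $n$. Let $\overline{pp}(n)$ denote the number of overpartition pairs of $n$. Then for every integer $n \ge 0$, $$\overline{pp}(8n+7) \equiv 0 \pmod{64},$$ $$\overline{pp}(20n+11) \equiv 0 \pmod 5,$$ $$\overline{pp}(20n+15) \equiv 0 \pmod 5,$$ $$\overline{pp}(20n+19) \equiv 0 \pmod 5.$$ -/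

import Mathlib

/-- An overpartition of `n`: a partition of `n` in which the first occurrence of each part size
may be overlined. It is recorded by the underlying partition and the set of those part sizes
whose first occurrence is overlined. -/
@[ext]
structure Overpartition (n : ℕ) where
  /-- the underlying partition -/
  partition : n.Partition
  /-- the part sizes whose first occurrence is overlined -/
  overlined : Finset ℕ
  /-- only sizes that do occur as parts can be overlined -/
  overlined_subset : overlined ⊆ partition.parts.toFinset

/-- An overpartition amounts to a partition with a subset of its set of part sizes. -/
def Overpartition.equivSigma (n : ℕ) :
    Overpartition n ≃ Σ p : n.Partition, {s : Finset ℕ // s ∈ p.parts.toFinset.powerset} where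
  toFun π := ⟨π.partition, π.overlined, Finset.mem_powerset.mpr π.overlined_subset⟩
  invFun x := ⟨x.1, x.2.1, Finset.mem_powerset.mp x.2.2⟩
  left_inv _ := rfl
  right_inv _ := rfl

instance Overpartition.instFintype (n : ℕ) : Fintype (Overpartition n) :=
  Fintype.ofEquiv _ (Overpartition.equivSigma n).symm

/-- An overpartition pair of `n`: an ordered pair `(fst, snd)` of overpartitions (either may be
the empty overpartition of `0`) such that the sum of all the parts of both is `n`; the pair
`sizes` records the numbers that the two components are overpartitions of. -/
structure OverpartitionPair (n : ℕ) where
  /-- the sizes of the two components, which add up to `n` -/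
  sizes : {k : ℕ × ℕ // k ∈ Finset.HasAntidiagonal.antidiagonal n}
  /-- the first component -/
  fst : Overpartition sizes.1.1
  /-- the second component -/
  snd : Overpartition sizes.1.2

/-- The structure of overpartition pairs written as a sigma type. -/
def OverpartitionPair.equivSigma (n : ℕ) :
    OverpartitionPair n ≃ Σ k : {k : ℕ × ℕ // k ∈ Finset.HasAntidiagonal.antidiagonal n},
      Overpartition k.1.1 × Overpartition k.1.2 where
  toFun π := ⟨π.sizes, π.fst, π.snd⟩
  invFun x := ⟨x.1, x.2.1, x.2.2⟩
  left_inv _ := rfl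
  right_inv _ := rfl

instance OverpartitionPair.instFintype (n : ℕ) : Fintype (OverpartitionPair n) :=
  Fintype.ofEquiv _ (OverpartitionPair.equivSigma n).symm

/-- The number of overpartition pairs of `n`. -/
def numOverpartitionPairs (n : ℕ) : ℕ := Fintype.card (OverpartitionPair n)

/-!
Overpartitions have generating function `O = 1 / φ(-q)` with `φ(q) = ∑ q^(j²)`, the sum being over
all integers (`phiNeg_mul_overGenFun`), so overpartition pairs have generating function `O²`. With
`ψ(q) = ∑ q^(k (k + 1) / 2)`, `k ≥ 0`, the classical relations
`φ(q) φ(-q) = φ(-q²)²`, `φ(q)² = φ(q²)² + 4 q ψ(q⁴)²` and `φ(q) ψ(q²) = ψ(q)²`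
split `O²` twice according to the parity of the exponent, which leads to
`∑ pp(4 n + 3) q^n = 32 ψ(q)⁶ / φ(-q)⁸` (`numOverpartitionPairs_four_mul_add_three`).

*Modulo 64.* The series `ψ⁶ / φ(-q)⁸` is a square, and a square has even coefficients at odd
exponents.

*Modulo 5.* One has `ψ⁶ / φ(-q)⁸ = (ψ / φ(-q)²)⁵ * ψ φ(-q)²`. Modulo 5, a fifth power has only
exponents divisible by 5, and `ψ(q) φ(-q)² = ∏ (1 - q^i)³`, which by Jacobi equals
`∑ (-1)^k (2 k + 1) q^(k (k + 1) / 2)`, `k ≥ 0`. If `k (k + 1) / 2` is congruent to 2, 3 or 4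
modulo 5, it is congruent to 3 and `2 k + 1` is divisible by 5. So the coefficients at
`n ≡ 2, 3, 4` modulo 5 vanish modulo 5, and these are the exponents `4 n + 3 ≡ 11, 15, 19`
modulo 20.

The three relations between theta series all come from the change of variables
`(j, k) = (u + v, u - v)` or `(u + v + 1, u - v)` on `ℤ × ℤ` (`eq_add_of_parity`). The product
formulas of Gauss and Jacobi come from a finite form of the Jacobi triple product
(`finite_jacobi_triple_product`), which is a version of the `q`-binomial theorem, by letting the
number of factors tend to infinity (`tendsto_sum_qBinom`); the cube of Euler's product appears
through the derivative in the variable `z` at a zero of the product (`finite_jacobi_cube`).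
Here `q` is the variable `X` of `ℤ⟦X⟧`, and `q ↦ q²` is `PowerSeries.expand 2`.
-/

namespace OverpartitionCongruence

open PowerSeries Filter
open scoped PowerSeries.WithPiTopology

/-! ### Theta series and their quadratic relations -/

/-- The triangular number `j (j + 1) / 2` of an integer `j`; it is a natural number for negative
`j` as well. -/
def triangular (j : ℤ) : ℕ := (j * (j + 1) / 2).toNat

lemma two_mul_triangular (j : ℤ) : 2 * (triangular j : ℤ) = j * (j + 1) := by
  have h : 0 ≤ j * (j + 1) := by
    rcases le_or_gt 0 j with h | h
    · positivity
    · exact mul_nonneg_of_nonpos_of_nonpos h.le (by lia)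
  have h2 : (2 : ℤ) ∣ j * (j + 1) := (Int.even_mul_succ_self j).two_dvd
  rw [triangular, Int.toNat_of_nonneg (by positivity)]
  lia

/-- The square of an integer, as a natural number. -/
def square (j : ℤ) : ℕ := j.natAbs ^ 2

lemma natCast_square (j : ℤ) : (square j : ℤ) = j ^ 2 := by
  simp [square]

/-- An exponent function on `ℤ` of at least linear growth, as needed for the convergence of
theta series. -/
def Growing (e : ℤ → ℕ) : Prop := ∀ j, |j| ≤ e j + 1

lemma growing_triangular : Growing triangular := fun j ↦ by
  have := two_mul_triangular j
  rw [abs_le]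
  constructor <;> nlinarith [sq_nonneg (j + 1), sq_nonneg j]

lemma growing_square : Growing square := fun j ↦ by
  rw [natCast_square, abs_le]
  constructor <;> nlinarith [sq_nonneg (j + 1), sq_nonneg (j - 1)]

/-- The theta series `∑ w(j) q^e(j)`, with `j` running over the integers. -/
noncomputable def theta (w : ℤ → ℤ) (e : ℤ → ℕ) : ℤ⟦X⟧ := ∑' j, monomial (e j) (w j)

lemma hasSum_theta (w : ℤ → ℤ) {e : ℤ → ℕ} (he : Growing e) :
    HasSum (fun j ↦ monomial (e j) (w j)) (theta w e) := by
  refine Summable.hasSum ((WithPiTopology.summable_iff_summable_coeff _).mpr fun d ↦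
    summable_of_hasFiniteSupport ((Set.finite_Icc (-(d + 1 : ℤ)) (d + 1)).subset fun j hj ↦ ?_))
  have : d = e j := by
    by_contra h
    simp [coeff_monomial, h] at hj
  have := he j
  rw [Set.mem_Icc]
  grind

lemma hasSum_theta_mul (w w' : ℤ → ℤ) {e e' : ℤ → ℕ} (he : Growing e) (he' : Growing e') :
    HasSum (fun p : ℤ × ℤ ↦ monomial (e p.1 + e' p.2) (w p.1 * w' p.2))
      (theta w e * theta w' e') := by
  simp_rw [← monomial_mul_monomial]
  refine HasSum.mul (f := fun j ↦ monomial (e j) (w j)) (g := fun j ↦ monomial (e' j) (w' j))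
    (hasSum_theta w he) (hasSum_theta w' he') ?_
  simp_rw [monomial_mul_monomial]
  refine (WithPiTopology.summable_iff_summable_coeff _).mpr fun d ↦
    summable_of_hasFiniteSupport (((Set.finite_Icc (-(d + 1 : ℤ)) (d + 1)).prod
      (Set.finite_Icc (-(d + 1 : ℤ)) (d + 1))).subset fun p hp ↦ ?_)
  have : d = e p.1 + e' p.2 := by
    by_contra h
    simp [coeff_monomial, h] at hp
  have := he p.1
  have := he' p.2
  rw [Set.mem_prod, Set.mem_Icc, Set.mem_Icc]
  grind

lemma hasSum_expand {ι : Type*} {f : ι → ℤ⟦X⟧} {F : ℤ⟦X⟧} {k : ℕ} (hk : k ≠ 0) (h : HasSum f F) :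
    HasSum (fun i ↦ expand k hk (f i)) (expand k hk F) := by
  rw [WithPiTopology.hasSum_iff_hasSum_coeff] at h ⊢
  intro d
  by_cases hd : k ∣ d
  · obtain ⟨m, rfl⟩ := hd
    simpa only [coeff_expand_mul] using h m
  · simp only [coeff_expand_of_not_dvd k hk _ hd]
    exact hasSum_zero

lemma hasSum_expand_theta_mul (w w' : ℤ → ℤ) {e e' : ℤ → ℕ} (he : Growing e) (he' : Growing e')
    {k : ℕ} (hk : k ≠ 0) :
    HasSum (fun p : ℤ × ℤ ↦ monomial (k * (e p.1 + e' p.2)) (w p.1 * w' p.2))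
      (expand k hk (theta w e * theta w' e')) := by
  simpa only [expand_monomial] using hasSum_expand hk (hasSum_theta_mul w w' he he')

lemma hasSum_X_mul {ι : Type*} {c : ι → ℕ} {w : ι → ℤ} {F : ℤ⟦X⟧}
    (h : HasSum (fun i ↦ monomial (c i) (w i)) F) :
    HasSum (fun i ↦ monomial (c i + 1) (w i)) (X * F) := by
  have := h.mul_left X
  simpa only [X_eq, monomial_mul_monomial, one_mul, add_comm] using this

/-- Pairs of integers with even sum are `(u + v, u - v)`, those with odd sum are
`(u + v + 1, u - v)`, each for a unique pair `(u, v)`. -/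
def parityEquiv : (ℤ × ℤ) ⊕ (ℤ × ℤ) ≃ ℤ × ℤ where
  toFun := Sum.elim (fun p ↦ (p.1 + p.2, p.1 - p.2)) (fun p ↦ (p.1 + p.2 + 1, p.1 - p.2))
  invFun p := if (p.1 + p.2) % 2 = 0 then .inl ((p.1 + p.2) / 2, (p.1 - p.2) / 2)
    else .inr ((p.1 + p.2) / 2, (p.1 - p.2) / 2)
  left_inv := by
    rintro (⟨u, v⟩ | ⟨u, v⟩)
    · have : (u + v + (u - v)) % 2 = 0 := by lia
      simp only [Sum.elim_inl, this, if_true, Sum.inl.injEq, Prod.mk.injEq]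
      lia
    · have : ¬ (u + v + 1 + (u - v)) % 2 = 0 := by lia
      simp only [Sum.elim_inr, this, if_false, Sum.inr.injEq, Prod.mk.injEq]
      lia
  right_inv := by
    rintro ⟨j, k⟩
    dsimp only
    split_ifs <;> simp only [Sum.elim_inl, Sum.elim_inr, Prod.mk.injEq] <;> lia

/-- A double series over `ℤ × ℤ` splits according to the parity of the sum of the indices. -/
lemma eq_add_of_parity {f : ℤ × ℤ → ℤ⟦X⟧} {F G H : ℤ⟦X⟧} (hF : HasSum f F)
    (hG : HasSum (fun p : ℤ × ℤ ↦ f (p.1 + p.2, p.1 - p.2)) G)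
    (hH : HasSum (fun p : ℤ × ℤ ↦ f (p.1 + p.2 + 1, p.1 - p.2)) H) : F = G + H := by
  refine HasSum.unique hF ((Equiv.hasSum_iff parityEquiv).mp ?_)
  exact HasSum.sum hG hH

lemma two_mul_square_add (u v : ℤ) :
    square (u + v) + square (u - v) = 2 * (square u + square v) := by
  zify
  simp only [natCast_square]
  ring

lemma square_add_one_add (u v : ℤ) :
    square (u + v + 1) + square (u - v) = 4 * (triangular u + triangular v) + 1 := by
  zify
  simp only [natCast_square]
  linear_combination -2 * two_mul_triangular u - 2 * two_mul_triangular v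

lemma triangular_add_add (u v : ℤ) :
    triangular (u + v) + triangular (u - v) = 2 * triangular u + square v := by
  zify
  rw [natCast_square]
  linarith [two_mul_triangular (u + v), two_mul_triangular (u - v), two_mul_triangular u]

lemma triangular_add_one_add (u v : ℤ) :
    triangular (u + v + 1) + triangular (u - v) = square (u + 1) + 2 * triangular v := by
  zify
  rw [natCast_square]
  linarith [two_mul_triangular (u + v + 1), two_mul_triangular (u - v), two_mul_triangular v]

/-- Ramanujan's `φ(q) = ∑ q^(j²)`. -/
noncomputable def phi : ℤ⟦X⟧ := theta 1 square

/-- `φ(-q) = ∑ (-1)^j q^(j²)`. -/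
noncomputable def phiNeg : ℤ⟦X⟧ := theta (fun j ↦ j.negOnePow) square

/-- `∑ q^(j (j + 1) / 2)` over all integers `j`. As `j` and `-1 - j` give the same exponent, this
is twice Ramanujan's `ψ(q)`. -/
noncomputable def twoPsi : ℤ⟦X⟧ := theta 1 triangular

lemma triangular_neg (j : ℤ) : triangular (-1 - j) = triangular j := by
  zify
  linarith [two_mul_triangular j, two_mul_triangular (-1 - j)]

/-- The terms for `j` and `-1 - j` cancel. -/
lemma theta_negOnePow_triangular : theta (fun j ↦ j.negOnePow) triangular = 0 := by
  have h := hasSum_theta (fun j ↦ j.negOnePow) growing_triangular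
  have h' := (Equiv.hasSum_iff (Equiv.subLeft (-1 : ℤ))).mpr h
  have key : ∀ j : ℤ, monomial (triangular (-1 - j)) (((-1 - j).negOnePow : ℤˣ) : ℤ)
      = - monomial (R := ℤ) (triangular j) ((j.negOnePow : ℤˣ) : ℤ) := fun j ↦ by
    rw [triangular_neg, Int.negOnePow_sub, ← map_neg]
    simp [Int.negOnePow_neg]
  have h'' : HasSum (fun j : ℤ ↦ - monomial (R := ℤ) (triangular j) ((j.negOnePow : ℤˣ) : ℤ))
      (theta (fun j ↦ j.negOnePow) triangular) := by
    convert h' using 2 with j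
    simp only [Function.comp_apply, Equiv.subLeft_apply]
    exact (key j).symm
  have h2 := h''.unique h.neg
  ext d
  have := congrArg (coeff d) h2
  simp only [map_neg, map_zero] at this ⊢
  lia

/-- The 2-dissection of `φ(q)²`. -/
lemma phi_sq :
    phi ^ 2 = expand 2 two_ne_zero (phi ^ 2) + X * expand 4 four_ne_zero (twoPsi ^ 2) := by
  simp only [sq]
  refine eq_add_of_parity (hasSum_theta_mul 1 1 growing_square growing_square) ?_ ?_
  · simp only [two_mul_square_add]
    exact hasSum_expand_theta_mul 1 1 growing_square growing_square two_ne_zero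
  · simp only [square_add_one_add]
    exact hasSum_X_mul
      (hasSum_expand_theta_mul 1 1 growing_triangular growing_triangular four_ne_zero)

/-- The identity `φ(q) φ(-q) = φ(-q²)²`. -/
lemma phi_mul_phiNeg : phi * phiNeg = expand 2 two_ne_zero (phiNeg ^ 2) := by
  rw [sq, ← add_zero (expand _ _ _)]
  have h0 : (0 : ℤ⟦X⟧) = X * expand 4 four_ne_zero (theta (fun j ↦ j.negOnePow) triangular
      * theta (fun j ↦ j.negOnePow) triangular) := by
    rw [theta_negOnePow_triangular]; simp
  rw [h0]
  have key (u v : ℤ) : (1 : ℤ) * ((u - v).negOnePow : ℤˣ)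
      = (u.negOnePow : ℤˣ) * (v.negOnePow : ℤˣ) := by
    rw [Int.negOnePow_sub]; simp
  refine eq_add_of_parity
    (hasSum_theta_mul 1 (fun j ↦ j.negOnePow) growing_square growing_square) ?_ ?_
  · simp only [two_mul_square_add, Pi.one_apply, key]
    exact hasSum_expand_theta_mul (fun j ↦ j.negOnePow) (fun j ↦ j.negOnePow)
      growing_square growing_square two_ne_zero
  · simp only [square_add_one_add, Pi.one_apply, key]
    exact hasSum_X_mul
      (hasSum_expand_theta_mul (fun j ↦ j.negOnePow) (fun j ↦ j.negOnePow)
        growing_triangular growing_triangular four_ne_zero)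

/-- The identity `φ(q) ψ(q²) = ψ(q)²`, for `2 ψ`. -/
lemma twoPsi_sq : twoPsi ^ 2 = 2 * (phi * expand 2 two_ne_zero twoPsi) := by
  rw [sq, two_mul]
  have hs : Growing fun j ↦ 2 * triangular j := fun j ↦ by
    have := growing_triangular j
    push_cast
    lia
  have hexp : expand 2 two_ne_zero twoPsi = theta 1 (fun j ↦ 2 * triangular j) := by
    refine HasSum.unique ?_ (hasSum_theta 1 hs)
    have h := hasSum_expand two_ne_zero (hasSum_theta 1 growing_triangular)
    simp only [expand_monomial] at h
    exact h
  rw [hexp]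
  have h1 := hasSum_theta_mul 1 1 growing_triangular growing_triangular
  refine eq_add_of_parity h1 ?_ ?_
  · simp only [triangular_add_add]
    rw [mul_comm phi]
    have h := hasSum_theta_mul 1 1 hs growing_square
    exact h
  · simp only [triangular_add_one_add]
    have h := hasSum_theta_mul 1 1 growing_square hs
    rw [← Equiv.hasSum_iff ((Equiv.addRight (1 : ℤ)).prodCongr (Equiv.refl ℤ))] at h
    exact h

/-! ### Gaussian binomials and the finite triple product -/

section GaussianBinomial

variable {R : Type*} [CommRing R]

/-- The Gaussian binomial coefficient `[n choose k]` at `q`, defined by Pascal's rule. -/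
def qBinom (q : R) : ℕ → ℕ → R
  | _, 0 => 1
  | 0, _ + 1 => 0
  | n + 1, k + 1 => qBinom q n k + q ^ (k + 1) * qBinom q n (k + 1)

@[simp] lemma qBinom_zero_right (q : R) (n : ℕ) : qBinom q n 0 = 1 := by
  cases n <;> rfl

lemma qBinom_succ_succ (q : R) (n k : ℕ) :
    qBinom q (n + 1) (k + 1) = qBinom q n k + q ^ (k + 1) * qBinom q n (k + 1) := rfl

lemma qBinom_eq_zero_of_lt (q : R) {n k : ℕ} (h : n < k) : qBinom q n k = 0 := by
  induction n generalizing k with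
  | zero => obtain ⟨k, rfl⟩ := Nat.exists_eq_add_of_lt h; rw [zero_add]; rfl
  | succ n ih =>
    obtain _ | k := k
    · lia
    · rw [qBinom_succ_succ, ih (by lia), ih (by lia)]; simp

@[simp] lemma qBinom_self (q : R) (n : ℕ) : qBinom q n n = 1 := by
  induction n with
  | zero => rfl
  | succ n ih => rw [qBinom_succ_succ, ih, qBinom_eq_zero_of_lt q n.lt_succ_self]; simp

/-- The second Pascal rule, reflected from the defining one by the symmetry `k ↦ n - k`. -/
lemma qBinom_succ_succ' (q : R) {n k : ℕ} (h : k ≤ n) :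
    qBinom q (n + 1) (k + 1) = q ^ (n - k) * qBinom q n k + qBinom q n (k + 1) := by
  induction n generalizing k with
  | zero =>
    obtain rfl : k = 0 := by lia
    simp [qBinom]
  | succ n ih =>
    obtain rfl | h' := h.eq_or_lt
    · simp [qBinom_eq_zero_of_lt q (n + 1).lt_succ_self]
    have h1 := ih (by lia : k ≤ n)
    have h2 := qBinom_succ_succ q n k
    rw [qBinom_succ_succ q (n + 1)]
    obtain _ | k := k
    · simp only [qBinom_zero_right, Nat.sub_zero] at *
      linear_combination q * h1 - h2
    · have h3 := ih (by lia : k ≤ n)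
      have h4 := qBinom_succ_succ q n k
      obtain ⟨m, rfl⟩ := Nat.exists_eq_add_of_le (by lia : k + 1 ≤ n)
      rw [show k + 1 + m - k = m + 1 by lia] at h3
      rw [show k + 1 + m - (k + 1) = m by lia] at h1
      rw [show k + 1 + m + 1 - (k + 1) = m + 1 by lia]
      linear_combination q ^ (k + 2) * h1 - h2 + h3 - q ^ (m + 1) * h4

/-- The finite `q`-Pochhammer product `(1 - q) ⋯ (1 - q ^ n)`. -/
def qFactorial (q : R) (n : ℕ) : R := ∏ i ∈ Finset.range n, (1 - q ^ (i + 1))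

lemma qFactorial_succ (q : R) (n : ℕ) :
    qFactorial q (n + 1) = qFactorial q n * (1 - q ^ (n + 1)) := Finset.prod_range_succ _ _

lemma qBinom_mul_qFactorial (q : R) (s t : ℕ) :
    qBinom q (s + t) s * (qFactorial q s * qFactorial q t) = qFactorial q (s + t) := by
  induction s generalizing t with
  | zero => simp [qFactorial]
  | succ s ih =>
    induction t with
    | zero => simp [qFactorial]
    | succ t iht =>
      have h1 := ih (t + 1)
      rw [show s + 1 + (t + 1) = s + (t + 1) + 1 by ring, qBinom_succ_succ, qFactorial_succ q s,
        qFactorial_succ q t, qFactorial_succ q (s + (t + 1))]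
      rw [show s + 1 + t = s + (t + 1) by ring, qFactorial_succ q s] at iht
      rw [qFactorial_succ q t] at h1
      linear_combination (1 - q ^ (s + 1)) * h1 + q ^ (s + 1) * (1 - q ^ (t + 1)) * iht

lemma triangular_add_one (j : ℤ) : (triangular (j + 1) : ℤ) = triangular j + j + 1 := by
  linarith [two_mul_triangular j, two_mul_triangular (j + 1)]

lemma triangular_neg' (j : ℤ) : (triangular (-j) : ℤ) = triangular j - j := by
  linarith [two_mul_triangular j, two_mul_triangular (-j)]

/-- The general term `a ^ (j (j + 1) / 2) * b ^ (j (j - 1) / 2)` of Ramanujan's theta function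
`f(a, b)`. -/
def thetaTerm (a b : R) (j : ℤ) : R := a ^ triangular j * b ^ triangular (-j)

lemma mul_thetaTerm_right {a b q : R} (hab : a * b = q) {n k : ℕ} {j : ℤ}
    (h : (k : ℤ) - n = j + 1) :
    q ^ k * thetaTerm a b j = b * q ^ n * thetaTerm a b (j + 1) := by
  subst hab
  have h1 := triangular_add_one j
  have h2 := triangular_neg' j
  have h3 := triangular_neg' (j + 1)
  have e1 : k + triangular j = n + triangular (j + 1) := by lia
  have e2 : k + triangular (-j) = 1 + n + triangular (-(j + 1)) := by lia
  calc _ = a ^ (k + triangular j) * b ^ (k + triangular (-j)) := by simp only [thetaTerm]; ring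
    _ = _ := by rw [e1, e2]; simp only [thetaTerm]; ring

lemma mul_thetaTerm_left {a b q : R} (hab : a * b = q) {m k : ℕ} {j : ℤ} (h : (k : ℤ) = m - j) :
    q ^ k * thetaTerm a b (j + 1) = a * q ^ m * thetaTerm a b j := by
  subst hab
  have h1 := triangular_add_one j
  have h2 := triangular_neg' j
  have h3 := triangular_neg' (j + 1)
  have e1 : k + triangular (j + 1) = 1 + m + triangular j := by lia
  have e2 : k + triangular (-(j + 1)) = m + triangular (-j) := by lia
  calc _ = a ^ (k + triangular (j + 1)) * b ^ (k + triangular (-(j + 1))) := by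
        simp only [thetaTerm]; ring
    _ = _ := by rw [e1, e2]; simp only [thetaTerm]; ring

/-- Multiplication of a polynomial in `z` by the linear factor `α + β z`, in coefficients. -/
lemma sum_range_mul_linear {N : ℕ} {f g : ℕ → R} (α β z : R) (hf : f (N + 1) = 0)
    (h0 : g 0 = α * f 0) (h : ∀ k ≤ N, g (k + 1) = α * f (k + 1) + β * f k) :
    ∑ k ∈ Finset.range (N + 2), g k * z ^ k =
      (α + β * z) * ∑ k ∈ Finset.range (N + 1), f k * z ^ k := by
  have h1 : ∑ k ∈ Finset.range (N + 1), f (k + 1) * z ^ (k + 1) + f 0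
      = ∑ k ∈ Finset.range (N + 1), f k * z ^ k := by
    have := Finset.sum_range_succ' (fun k ↦ f k * z ^ k) (N + 1)
    rw [Finset.sum_range_succ] at this
    simpa [hf] using this.symm
  rw [Finset.sum_range_succ']
  have h2 : ∑ k ∈ Finset.range (N + 1), g (k + 1) * z ^ (k + 1)
      = α * ∑ k ∈ Finset.range (N + 1), f (k + 1) * z ^ (k + 1)
        + β * z * ∑ k ∈ Finset.range (N + 1), f k * z ^ k := by
    rw [Finset.mul_sum, Finset.mul_sum, ← Finset.sum_add_distrib]
    refine Finset.sum_congr rfl fun k hk ↦ ?_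
    rw [h k (by grind)]
    ring
  rw [h2, ← h1, h0]
  ring

/-- The finite form of the Jacobi triple product: for `a * b = q`, the `q`-binomial theorem for
`m + n` factors, with the exponents centred at `n`. -/
lemma finite_jacobi_triple_product {a b q : R} (hab : a * b = q) (z : R) (m n : ℕ) :
    (∏ i ∈ Finset.range m, (1 + a * q ^ i * z)) * ∏ i ∈ Finset.range n, (b * q ^ i + z) =
      ∑ k ∈ Finset.range (m + n + 1), qBinom q (m + n) k * thetaTerm a b (k - n) * z ^ k := by
  induction m with
  | zero =>
    induction n with
    | zero => simp [thetaTerm, triangular]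
    | succ n ih =>
      rw [Finset.prod_range_succ, ← mul_assoc, ih]
      simp only [zero_add]
      have h0 : thetaTerm a b ((0 : ℤ) - (n + 1 : ℕ)) =
          b * q ^ n * thetaTerm a b ((0 : ℤ) - n) := by
        have := mul_thetaTerm_right hab (n := n) (k := 0) (j := (0 : ℤ) - (n + 1 : ℕ))
          (by push_cast; ring)
        rw [pow_zero, one_mul] at this
        rw [this]
        congr 2
        push_cast
        ring
      rw [sum_range_mul_linear (f := fun k ↦ qBinom q n k * thetaTerm a b (k - n)) (b * q ^ n) 1 z]
      · ring
      · simp [qBinom_eq_zero_of_lt]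
      · simpa using h0
      · intro k hk
        have := mul_thetaTerm_right hab (n := n) (k := k + 1) (j := (k : ℤ) - n)
          (by push_cast; ring)
        have e1 : ((k + 1 : ℕ) : ℤ) - (n + 1 : ℕ) = k - n := by push_cast; ring
        have e2 : ((k + 1 : ℕ) : ℤ) - n = (k : ℤ) - n + 1 := by push_cast; ring
        rw [qBinom_succ_succ, e1, e2]
        linear_combination qBinom q n (k + 1) * this
  | succ m ih =>
    rw [Finset.prod_range_succ, mul_right_comm, ih,
      show m + 1 + n + 1 = m + n + 2 by ring, show m + 1 + n = m + n + 1 by ring]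
    rw [sum_range_mul_linear (f := fun k ↦ qBinom q (m + n) k * thetaTerm a b (k - n)) 1
      (a * q ^ m) z]
    · ring
    · simp [qBinom_eq_zero_of_lt]
    · simp
    · intro k hk
      have := mul_thetaTerm_left hab (m := m) (k := m + n - k) (j := (k : ℤ) - n)
        (by push_cast [hk]; ring)
      have e2 : ((k + 1 : ℕ) : ℤ) - n = (k : ℤ) - n + 1 := by push_cast; ring
      rw [qBinom_succ_succ' q hk, e2]
      linear_combination qBinom q (m + n) k * this

lemma prod_range_add_neg_one (f : ℕ → R) (n : ℕ) :
    ∏ i ∈ Finset.range n, (f i + -1) = (-1) ^ n * ∏ i ∈ Finset.range n, (1 - f i) := by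
  have := Finset.prod_neg (s := Finset.range n) (fun i ↦ 1 - f i)
  rw [Finset.card_range] at this
  rw [← this]
  exact Finset.prod_congr rfl fun i _ ↦ by ring

/-- Jacobi's identity in finite form: the derivative in `z` of the finite triple product at its
zero `z = -1`. As the product vanishes there, the factor `k` produced by differentiation may be
replaced by the symmetric weight `2 (k - (n + 1)) + 1`, at the cost of a factor `2`. -/
lemma finite_jacobi_cube (q : R) (n : ℕ) :
    ∑ k ∈ Finset.range (2 * (n + 1) + 1), qBinom q (2 * (n + 1)) k *
      q ^ triangular (k - (n + 1 : ℕ)) * ((-1) ^ k * (2 * ((k : R) - (n + 1 : ℕ)) + 1)) =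
    2 * ((-1) ^ (n + 1) * (qFactorial q (n + 1) * qFactorial q n)) := by
  -- The triple product over `R[z]` with `a = q`, `b = 1`; its last factor for `i = 0` is `1 + z`.
  have h := finite_jacobi_triple_product (a := Polynomial.C q) (b := 1) (mul_one _)
    (Polynomial.X : Polynomial R) (n + 1) (n + 1)
  rw [Finset.prod_range_succ' (fun i ↦ 1 * Polynomial.C q ^ i + Polynomial.X) n, ← two_mul] at h
  rw [← mul_assoc] at h
  have hterm (k : ℕ) : thetaTerm (Polynomial.C q) (1 : Polynomial R) (k - (n + 1 : ℕ))
      = Polynomial.C (q ^ triangular (k - (n + 1 : ℕ))) := by simp [thetaTerm]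
  have hbinom (N k : ℕ) : qBinom (Polynomial.C q) N k = Polynomial.C (qBinom q N k) := by
    induction N generalizing k with
    | zero => cases k <;> simp [qBinom]
    | succ N ih => cases k <;> simp [qBinom_succ_succ, ih]
  simp only [hterm, hbinom, ← Polynomial.C_mul] at h
  generalize hc : (fun k : ℕ ↦ qBinom q (2 * (n + 1)) k * q ^ triangular (k - (n + 1 : ℕ))) = c
  have hc' (k : ℕ) : qBinom q (2 * (n + 1)) k * q ^ triangular (k - (n + 1 : ℕ)) = c k :=
    congrFun hc k
  simp only [hc'] at h ⊢
  have h0 := congrArg (Polynomial.eval (-1)) h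
  have h1 := congrArg (fun p ↦ Polynomial.eval (-1) (Polynomial.derivative p)) h
  simp only [Polynomial.eval_mul, Polynomial.eval_finsetSum, Polynomial.derivative_sum,
    Polynomial.derivative_mul, Polynomial.eval_add, Polynomial.derivative_add,
    Polynomial.derivative_X_pow, Polynomial.eval_prod, Polynomial.derivative_C] at h0 h1
  simp only [Polynomial.eval_C, Polynomial.eval_X, Polynomial.eval_pow, Polynomial.eval_one,
    pow_zero, mul_one, add_neg_cancel, mul_zero, zero_mul, zero_add,
    Polynomial.derivative_X, Polynomial.derivative_one, one_mul, Polynomial.eval_zero] at h0 h1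
  have hA : ∏ i ∈ Finset.range (n + 1), (1 + q * q ^ i * -1) = qFactorial q (n + 1) :=
    Finset.prod_congr rfl fun i _ ↦ by ring
  have hB : ∏ i ∈ Finset.range n, (q ^ (i + 1) + -1) = (-1) ^ n * qFactorial q n := by
    exact prod_range_add_neg_one _ n
  simp only [hA, hB] at h1
  have hk (k : ℕ) : (k : R) * (-1) ^ (k - 1) = -(k * (-1) ^ k) := by
    cases k with
    | zero => simp
    | succ k => rw [Nat.add_sub_cancel, pow_succ]; ring
  have hsum : ∑ k ∈ Finset.range (2 * (n + 1) + 1),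
      c k * ((-1) ^ k * (2 * ((k : R) - (n + 1 : ℕ)) + 1)) =
      -2 * ∑ k ∈ Finset.range (2 * (n + 1) + 1), c k * (k * (-1) ^ (k - 1)) +
      (1 - 2 * (n + 1 : ℕ)) * ∑ k ∈ Finset.range (2 * (n + 1) + 1), c k * (-1) ^ k := by
    rw [Finset.mul_sum, Finset.mul_sum, ← Finset.sum_add_distrib]
    refine Finset.sum_congr rfl fun k _ ↦ ?_
    rw [hk]
    ring
  rw [hsum, ← h0, ← h1]
  ring

end GaussianBinomial

/-! ### Product formulas of Gauss and Jacobi -/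

lemma tendsto_of_X_pow_dvd_sub {f g : ℕ → ℤ⟦X⟧} {F : ℤ⟦X⟧} (hg : Tendsto g atTop (nhds F))
    (h : ∀ n, X ^ n ∣ f n - g n) : Tendsto f atTop (nhds F) := by
  rw [WithPiTopology.tendsto_iff_coeff_tendsto] at hg ⊢
  intro d
  refine (hg d).congr' ?_
  filter_upwards [eventually_gt_atTop d] with n hn
  have := X_pow_dvd_iff.mp (h n) d hn
  rw [map_sub] at this
  lia

/-- The partial products of `∏ f i` approximate the limit to order `n + 1` when the factors
satisfy `f i ≡ 1` to order `i + 1`. -/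
lemma X_pow_dvd_sub_prod {f : ℕ → ℤ⟦X⟧} {F : ℤ⟦X⟧} (hf : HasProd f F)
    (h : ∀ i, X ^ (i + 1) ∣ f i - 1) (n : ℕ) :
    X ^ (n + 1) ∣ F - ∏ i ∈ Finset.range n, f i := by
  have hfin (M : ℕ) : X ^ (n + 1) ∣
      ∏ i ∈ Finset.range (n + M), f i - ∏ i ∈ Finset.range n, f i := by
    induction M with
    | zero => simp
    | succ M ih =>
      have h1 : (X : ℤ⟦X⟧) ^ (n + 1) ∣ f (n + M) - 1 :=
        (pow_dvd_pow X (by lia)).trans (h (n + M))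
      have := (h1.mul_left (∏ i ∈ Finset.range (n + M), f i)).add ih
      rw [← add_assoc, Finset.prod_range_succ]
      convert this using 1
      ring
  rw [X_pow_dvd_iff]
  intro d hd
  have ht := (WithPiTopology.tendsto_iff_coeff_tendsto _ _ _ _).mp hf.tendsto_prod_nat d
  have hc : Tendsto (fun N ↦ coeff d (∏ i ∈ Finset.range N, f i)) atTop
      (nhds (coeff d (∏ i ∈ Finset.range n, f i))) := by
    refine tendsto_const_nhds.congr' ?_
    filter_upwards [eventually_ge_atTop n] with N hN
    obtain ⟨M, rfl⟩ := Nat.exists_eq_add_of_le hN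
    have := X_pow_dvd_iff.mp (hfin M) d hd
    rw [map_sub] at this
    lia
  rw [map_sub, tendsto_nhds_unique ht hc, sub_self]

lemma multipliable_one_add {f : ℕ → ℤ⟦X⟧} (h : ∀ i, X ^ i ∣ f i) : Multipliable (1 + f ·) := by
  refine WithPiTopology.multipliable_one_add_of_tendsto_order_atTop_nhds_top _ ?_
  refine ENat.tendsto_nhds_top_iff_natCast_lt.mpr fun n ↦
    eventually_atTop.mpr ⟨n + 1, fun m hm ↦ ?_⟩
  refine lt_of_lt_of_le (Nat.cast_lt.mpr hm) (le_order _ _ fun i hi ↦ ?_)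
  exact X_pow_dvd_iff.mp (h m) i (Nat.cast_lt.mp hi)

/-- Euler's product `∏ (1 - q^(r (i + 1)))`. -/
noncomputable def euler (r : ℕ) : ℤ⟦X⟧ := ∏' i : ℕ, (1 - (X ^ r) ^ (i + 1))

lemma hasProd_euler {r : ℕ} (hr : 1 ≤ r) :
    HasProd (fun i : ℕ ↦ (1 - (X ^ r) ^ (i + 1) : ℤ⟦X⟧)) (euler r) := by
  refine Multipliable.hasProd ?_
  simp only [sub_eq_add_neg]
  refine multipliable_one_add fun i ↦ ?_
  rw [dvd_neg, ← pow_mul]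
  exact pow_dvd_pow X (by nlinarith)

lemma X_pow_dvd_euler_sub_qFactorial {r : ℕ} (hr : 1 ≤ r) (n : ℕ) :
    X ^ (n + 1) ∣ euler r - qFactorial (X ^ r) n := by
  refine X_pow_dvd_sub_prod (hasProd_euler hr) (fun i ↦ ?_) n
  rw [sub_sub_cancel_left, dvd_neg, ← pow_mul]
  exact pow_dvd_pow X (by nlinarith)

lemma isUnit_euler {r : ℕ} (hr : 1 ≤ r) : IsUnit (euler r) := by
  have := X_pow_dvd_iff.mp (X_pow_dvd_euler_sub_qFactorial hr 0) 0 (by lia)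
  rw [isUnit_iff_constantCoeff]
  simp only [qFactorial, Finset.range_zero, Finset.prod_empty, map_sub,
    coeff_zero_eq_constantCoeff, map_one] at this
  rw [sub_eq_zero.mp this]
  exact isUnit_one

/-- Gaussian binomial coefficients tend to the reciprocal of Euler's product. -/
lemma X_pow_dvd_euler_mul_qBinom_sub_one {r : ℕ} (hr : 1 ≤ r) {s t μ : ℕ} (hs : μ ≤ s)
    (ht : μ ≤ t) : X ^ (μ + 1) ∣ euler r * qBinom (X ^ r) (s + t) s - 1 := by
  have key {n : ℕ} (hn : μ ≤ n) : X ^ (μ + 1) ∣ euler r - qFactorial (X ^ r) n :=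
    (pow_dvd_pow X (by lia)).trans (X_pow_dvd_euler_sub_qFactorial hr n)
  -- Modulo `X ^ (μ + 1)` the three `q`-factorials in the formula for `[s + t choose s]` agree
  -- with Euler's product, which is a unit.
  rw [← (isUnit_euler hr).dvd_mul_left (a := X ^ (μ + 1))]
  have e : euler r * (euler r * qBinom (X ^ r) (s + t) s - 1)
      = qBinom (X ^ r) (s + t) s * (euler r * (euler r - qFactorial (X ^ r) t)
        + qFactorial (X ^ r) t * (euler r - qFactorial (X ^ r) s))
        - (euler r - qFactorial (X ^ r) (s + t)) := by
    rw [← qBinom_mul_qFactorial (X ^ r : ℤ⟦X⟧) s t]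
    ring
  rw [e]
  exact ((((key ht).mul_left _).add ((key hs).mul_left _)).mul_left _).sub (key (by lia))

lemma sum_range_eq_sum_Icc {M : Type*} [AddCommMonoid M] (g : ℤ → M) (n : ℕ) :
    ∑ k ∈ Finset.range (2 * n + 1), g (k - n) = ∑ j ∈ Finset.Icc (-n : ℤ) n, g j := by
  refine Finset.sum_nbij' (fun k ↦ (k : ℤ) - n) (fun j ↦ (j + n).toNat) ?_ ?_ ?_ ?_ ?_ <;>
    simp only [Finset.mem_range, Finset.mem_Icc] <;> intros <;> first | rfl | lia

/-- Theta series are limits of the sums in the finite triple product, normalized by Euler's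
product. -/
lemma tendsto_sum_qBinom {r : ℕ} (hr : 1 ≤ r) (w : ℤ → ℤ) {e : ℤ → ℕ} (he : Growing e) :
    Tendsto (fun n : ℕ ↦ euler r * ∑ k ∈ Finset.range (2 * n + 1),
      qBinom (X ^ r) (2 * n) k * monomial (e (k - n)) (w (k - n))) atTop (nhds (theta w e)) := by
  have hIcc : Tendsto (fun n : ℕ ↦ Finset.Icc (-n : ℤ) n) atTop atTop := by
    refine tendsto_atTop_finset_of_monotone (fun a b h ↦ ?_) fun j ↦ ⟨j.natAbs, ?_⟩
    · exact Finset.Icc_subset_Icc (by lia) (by lia)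
    · rw [Finset.mem_Icc]; lia
  refine tendsto_of_X_pow_dvd_sub (Tendsto.comp (hasSum_theta w he) hIcc) fun n ↦ ?_
  rw [Function.comp_apply, ← sum_range_eq_sum_Icc, Finset.mul_sum, ← Finset.sum_sub_distrib]
  refine Finset.dvd_sum fun k hk ↦ ?_
  have hk : k ≤ 2 * n := by grind
  obtain ⟨t, ht⟩ := Nat.exists_eq_add_of_le hk
  rw [ht]
  have h1 := X_pow_dvd_euler_mul_qBinom_sub_one hr (min_le_left k t) (min_le_right k t)
  have h2 : (X : ℤ⟦X⟧) ^ e (k - n) ∣ monomial (e (k - n)) (w (k - n)) := by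
    rw [monomial_eq_C_mul_X_pow]
    exact dvd_mul_left _ _
  have h3 := mul_dvd_mul h1 h2
  rw [← pow_add] at h3
  have h4 := he (k - n)
  -- The error term has order at least `e(j) + (n - |j| + 1) ≥ n`, where `j = k - n`.
  have h5 : n ≤ min k t + 1 + e (k - n) := by
    rcases abs_cases ((k : ℤ) - n) with h | h <;> lia
  refine (pow_dvd_pow X h5).trans (h3.trans (dvd_of_eq ?_))
  ring

/-- `∏ (1 - q^(2 i + 1))`. -/
noncomputable def oddProd : ℤ⟦X⟧ := ∏' i : ℕ, (1 - X ^ (2 * i + 1))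

/-- `∏ (1 + q^(i + 1))`. -/
noncomputable def plusProd : ℤ⟦X⟧ := ∏' i : ℕ, (1 + X ^ (i + 1))

lemma hasProd_oddProd : HasProd (fun i : ℕ ↦ (1 - X ^ (2 * i + 1) : ℤ⟦X⟧)) oddProd := by
  refine Multipliable.hasProd ?_
  simp only [sub_eq_add_neg]
  refine multipliable_one_add fun i ↦ ?_
  rw [dvd_neg]
  exact pow_dvd_pow X (by lia)

lemma hasProd_plusProd : HasProd (fun i : ℕ ↦ (1 + X ^ (i + 1) : ℤ⟦X⟧)) plusProd :=
  (multipliable_one_add fun i ↦ pow_dvd_pow X (by lia)).hasProd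

lemma oddProd_mul_euler_two : oddProd * euler 2 = euler 1 := by
  refine HasProd.unique (HasProd.even_mul_odd (f := fun i ↦ 1 - X ^ (i + 1)) hasProd_oddProd ?_) ?_
  · convert hasProd_euler one_le_two using 3 with i
    rw [← pow_mul]
    ring
  · simpa using hasProd_euler le_rfl

lemma plusProd_mul_euler_one : plusProd * euler 1 = euler 2 := by
  refine HasProd.unique (hasProd_plusProd.mul (hasProd_euler le_rfl)) ?_
  convert hasProd_euler one_le_two using 2 with i
  ring

/-- Euler's theorem on partitions into odd parts and into distinct parts. -/
lemma oddProd_mul_plusProd : oddProd * plusProd = 1 := by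
  refine (isUnit_euler le_rfl).mul_right_cancel ?_
  rw [mul_assoc, plusProd_mul_euler_one, oddProd_mul_euler_two, one_mul]

lemma neg_one_pow_mul_self (n : ℕ) : (-1 : ℤ⟦X⟧) ^ n * (-1) ^ n = 1 := by
  rw [← mul_pow]; simp

lemma monomial_negOnePow_sub (d k n : ℕ) :
    monomial (R := ℤ) d ((k - n : ℤ).negOnePow : ℤ) = (-1) ^ n * ((-1) ^ k * X ^ d) := by
  rw [monomial_eq_C_mul_X_pow, Int.negOnePow_sub, Int.negOnePow_def, Int.negOnePow_def]
  simp only [zpow_natCast, Units.val_mul, Units.val_pow_eq_pow_val, Units.val_neg, Units.val_one,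
    map_mul, map_pow, map_neg, map_one]
  ring

/-- Gauss's product for `φ(-q)`. -/
lemma phiNeg_eq : phiNeg = oddProd * euler 1 := by
  have h := tendsto_sum_qBinom one_le_two (fun j ↦ j.negOnePow) growing_square
  have hp := hasProd_oddProd.tendsto_prod_nat
  have hp' := (hp.mul hp).const_mul (euler 2)
  rw [← oddProd_mul_euler_two]
  refine (tendsto_nhds_unique h (hp'.congr fun n ↦ ?_)).trans (by ring)
  congr 1
  have hj := finite_jacobi_triple_product (a := X) (b := X) (q := (X ^ 2 : ℤ⟦X⟧)) (by ring) (-1) n n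
  have h1 : ∏ i ∈ Finset.range n, (1 + X * (X ^ 2) ^ i * -1 : ℤ⟦X⟧)
      = ∏ i ∈ Finset.range n, (1 - X ^ (2 * i + 1)) := Finset.prod_congr rfl fun i _ ↦ by ring
  have h2 : ∏ i ∈ Finset.range n, (X * (X ^ 2) ^ i + -1 : ℤ⟦X⟧)
      = (-1) ^ n * ∏ i ∈ Finset.range n, (1 - X ^ (2 * i + 1)) := by
    rw [prod_range_add_neg_one]
    exact congrArg _ (Finset.prod_congr rfl fun i _ ↦ by ring)
  rw [h1, h2] at hj
  calc _ = (-1) ^ n * ((∏ i ∈ Finset.range n, (1 - X ^ (2 * i + 1) : ℤ⟦X⟧)) *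
        ((-1) ^ n * ∏ i ∈ Finset.range n, (1 - X ^ (2 * i + 1)))) := by
        linear_combination (-(∏ i ∈ Finset.range n, (1 - X ^ (2 * i + 1) : ℤ⟦X⟧)) ^ 2) *
          neg_one_pow_mul_self n
    _ = _ := by
        rw [hj, Finset.mul_sum, ← two_mul]
        refine Finset.sum_congr rfl fun k _ ↦ ?_
        have hsq : square (k - n) = triangular (k - n) + triangular (-(k - n)) := by
          zify
          linarith [natCast_square (k - n), triangular_neg' (k - n), two_mul_triangular (k - n)]
        rw [monomial_negOnePow_sub, hsq, thetaTerm]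
        ring

/-- Gauss's product for `ψ(q)`. -/
lemma twoPsi_eq : twoPsi = 2 * (plusProd ^ 2 * euler 1) := by
  -- With `n + 1` factors on each side, the factor `b q^0 + z = 2` can be split off.
  have h := (tendsto_add_atTop_iff_nat 1).mpr (tendsto_sum_qBinom le_rfl 1 growing_triangular)
  have hp := hasProd_plusProd.tendsto_prod_nat
  have hp' := (((tendsto_add_atTop_iff_nat 1).mpr hp).mul hp).const_mul (2 * euler 1)
  refine (tendsto_nhds_unique h (hp'.congr fun n ↦ ?_)).trans (by ring)
  have hj := finite_jacobi_triple_product (a := X ^ 1) (b := 1) (q := (X ^ 1 : ℤ⟦X⟧)) (by ring) 1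
    (n + 1) (n + 1)
  rw [Finset.prod_range_succ' (fun i ↦ 1 * (X ^ 1) ^ i + 1)] at hj
  have h1 : ∏ i ∈ Finset.range (n + 1), (1 + X ^ 1 * (X ^ 1) ^ i * 1 : ℤ⟦X⟧)
      = ∏ i ∈ Finset.range (n + 1), (1 + X ^ (i + 1)) := Finset.prod_congr rfl fun i _ ↦ by ring
  have h2 : ∏ i ∈ Finset.range n, (1 * (X ^ 1) ^ (i + 1) + 1 : ℤ⟦X⟧)
      = ∏ i ∈ Finset.range n, (1 + X ^ (i + 1)) := Finset.prod_congr rfl fun i _ ↦ by ring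
  rw [h1, h2] at hj
  have h3 : ∑ k ∈ Finset.range (2 * (n + 1) + 1), qBinom (X ^ 1 : ℤ⟦X⟧) (2 * (n + 1)) k *
      monomial (triangular (k - (n + 1 : ℕ))) ((1 : ℤ → ℤ) (k - (n + 1 : ℕ))) =
      ∑ k ∈ Finset.range (n + 1 + (n + 1) + 1), qBinom (X ^ 1 : ℤ⟦X⟧) (n + 1 + (n + 1)) k *
      thetaTerm (X ^ 1) 1 (k - (n + 1 : ℕ)) * 1 ^ k := by
    rw [← two_mul]
    refine Finset.sum_congr rfl fun k _ ↦ ?_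
    rw [monomial_eq_C_mul_X_pow, thetaTerm, Pi.one_apply, map_one]
    ring
  rw [h3, ← hj]
  ring

/-- Jacobi's identity for the cube of Euler's product. The sum is over all integers, where `j` and
`-1 - j` give the same term. -/
lemma two_mul_euler_cube :
    2 * euler 1 ^ 3 = theta (fun j ↦ j.negOnePow * (2 * j + 1)) triangular := by
  have h := (tendsto_add_atTop_iff_nat 1).mpr (tendsto_sum_qBinom le_rfl
    (fun j ↦ j.negOnePow * (2 * j + 1)) growing_triangular)
  have hp := (hasProd_euler le_rfl).tendsto_prod_nat
  have hp' := (((tendsto_add_atTop_iff_nat 1).mpr hp).mul hp).const_mul (2 * euler 1)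
  refine (tendsto_nhds_unique (hp'.congr fun n ↦ ?_) h).symm.trans (by ring) |>.symm
  have hj := finite_jacobi_cube (X ^ 1 : ℤ⟦X⟧) n
  have h3 : ∑ k ∈ Finset.range (2 * (n + 1) + 1), qBinom (X ^ 1 : ℤ⟦X⟧) (2 * (n + 1)) k *
      monomial (triangular (k - (n + 1 : ℕ))) (((k - (n + 1 : ℕ) : ℤ).negOnePow : ℤ) *
        (2 * (k - (n + 1 : ℕ)) + 1)) =
      (-1) ^ (n + 1) * ∑ k ∈ Finset.range (2 * (n + 1) + 1), qBinom (X ^ 1 : ℤ⟦X⟧) (2 * (n + 1)) k *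
      (X ^ 1) ^ triangular (k - (n + 1 : ℕ)) *
        ((-1) ^ k * (2 * ((k : ℤ⟦X⟧) - ((n + 1 : ℕ) : ℤ⟦X⟧)) + 1)) := by
    rw [Finset.mul_sum]
    refine Finset.sum_congr rfl fun k _ ↦ ?_
    have := monomial_negOnePow_sub (triangular (k - (n + 1 : ℕ))) k (n + 1)
    rw [monomial_eq_C_mul_X_pow] at this
    rw [monomial_eq_C_mul_X_pow, map_mul, mul_right_comm, this]
    simp only [map_add, map_mul, map_sub, map_natCast, map_one, map_ofNat]
    ring
  rw [h3, hj]
  simp only [qFactorial]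
  linear_combination (-2 * euler 1 * (∏ i ∈ Finset.range (n + 1), (1 - (X ^ 1) ^ (i + 1) : ℤ⟦X⟧)) *
    ∏ i ∈ Finset.range n, (1 - (X ^ 1) ^ (i + 1) : ℤ⟦X⟧)) * neg_one_pow_mul_self (n + 1)

/-! ### Generating functions of overpartitions and overpartition pairs -/

lemma card_overpartition (n : ℕ) :
    Fintype.card (Overpartition n) = ∑ p : n.Partition, 2 ^ p.parts.toFinset.card := by
  rw [Fintype.card_congr (Overpartition.equivSigma n), Fintype.card_sigma]
  refine Finset.sum_congr rfl fun p _ ↦ ?_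
  rw [Fintype.card_coe, Finset.card_powerset]

/-- The generating function of overpartitions: every part size that occurs counts twice. -/
noncomputable def overGenFun : ℤ⟦X⟧ := Nat.Partition.genFun fun _ _ ↦ 2

lemma coeff_overGenFun (n : ℕ) : coeff n overGenFun = Fintype.card (Overpartition n) := by
  rw [overGenFun, Nat.Partition.coeff_genFun, card_overpartition]
  push_cast
  refine Finset.sum_congr rfl fun p _ ↦ ?_
  rw [Finsupp.prod, Finset.prod_const, Multiset.toFinsupp_support]

lemma numOverpartitionPairs_eq_coeff (n : ℕ) :
    (numOverpartitionPairs n : ℤ) = coeff n (overGenFun ^ 2) := by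
  rw [numOverpartitionPairs, Fintype.card_congr (OverpartitionPair.equivSigma n),
    Fintype.card_sigma, sq, coeff_mul]
  simp only [coeff_overGenFun, Fintype.card_prod, Nat.cast_sum, Nat.cast_mul]
  exact Finset.sum_coe_sort (Finset.HasAntidiagonal.antidiagonal n) (fun k : ℕ × ℕ ↦
    (Fintype.card (Overpartition k.1) : ℤ) * Fintype.card (Overpartition k.2))

/-- `1 + 2 y + 2 y² + ⋯ = (1 + y) / (1 - y)` for `y = q^(i + 1)`. -/
lemma overpartition_factor (i : ℕ) :
    (1 + ∑' j : ℕ, (2 : ℤ) • (X : ℤ⟦X⟧) ^ ((i + 1) * (j + 1))) * (1 - (X ^ 1) ^ (i + 1)) =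
      1 + X ^ (i + 1) := by
  have h0 : (X ^ (i + 1) : ℤ⟦X⟧).constantCoeff = 0 := by simp
  have h1 := WithPiTopology.one_sub_mul_tsum_pow_of_constantCoeff_eq_zero h0
  have h2 : ∑' j : ℕ, (2 : ℤ) • (X : ℤ⟦X⟧) ^ ((i + 1) * (j + 1))
      = 2 * X ^ (i + 1) * ∑' j : ℕ, (X ^ (i + 1) : ℤ⟦X⟧) ^ j := by
    rw [← (WithPiTopology.summable_pow_of_constantCoeff_eq_zero h0).tsum_mul_left]
    refine tsum_congr fun j ↦ ?_
    rw [zsmul_eq_mul]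
    push_cast
    ring
  rw [h2, pow_one]
  linear_combination (2 * X ^ (i + 1)) * h1

lemma overGenFun_mul_euler : overGenFun * euler 1 = plusProd := by
  have h : HasProd (fun i : ℕ ↦ (1 + ∑' j : ℕ, (2 : ℤ) • (X : ℤ⟦X⟧) ^ ((i + 1) * (j + 1))) *
      (1 - (X ^ 1) ^ (i + 1))) (overGenFun * euler 1) :=
    HasProd.mul (Nat.Partition.hasProd_genFun (R := ℤ) fun _ _ ↦ 2) (hasProd_euler le_rfl)
  simp only [overpartition_factor] at h
  exact h.unique hasProd_plusProd

lemma phiNeg_mul_overGenFun : phiNeg * overGenFun = 1 := by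
  rw [phiNeg_eq, mul_assoc, mul_comm (euler 1), overGenFun_mul_euler, oddProd_mul_plusProd]

/-! ### Dissections and congruences -/

/-- Ramanujan's `ψ(q) = ∑ q^(k (k + 1) / 2)` over `k ≥ 0`, given by its product. -/
noncomputable def psi : ℤ⟦X⟧ := plusProd ^ 2 * euler 1

lemma two_mul_psi : 2 * psi = twoPsi := twoPsi_eq.symm

/-- The identity `ψ(q) φ(-q)² = ∏ (1 - q^i)³`. -/
lemma psi_mul_phiNeg_sq : psi * phiNeg ^ 2 = euler 1 ^ 3 := by
  rw [psi, phiNeg_eq]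
  linear_combination (euler 1 ^ 3 * (oddProd * plusProd + 1)) * oddProd_mul_plusProd

/-- The identity `ψ(q)² = φ(q) ψ(q²)`. -/
lemma psi_sq : psi ^ 2 = phi * expand 2 two_ne_zero psi := by
  have h := twoPsi_sq
  rw [← two_mul_psi, map_mul, map_ofNat] at h
  have h4 : (4 : ℤ⟦X⟧) ≠ 0 := fun h0 ↦ by
    have := congrArg constantCoeff h0
    rw [map_ofNat, map_zero] at this
    lia
  exact mul_left_cancel₀ h4 (by linear_combination h)

/-- `phi_sq` with `4` written out, all expansions being iterates of `q ↦ q²`. -/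
lemma phi_sq_eq : phi ^ 2 = expand 2 two_ne_zero (phi ^ 2) +
    4 * (X * expand 2 two_ne_zero (expand 2 two_ne_zero (psi ^ 2))) := by
  have h4 : expand 4 four_ne_zero (twoPsi ^ 2)
      = expand 2 two_ne_zero (expand 2 two_ne_zero (twoPsi ^ 2)) :=
    expand_mul 2 two_ne_zero 2 two_ne_zero _
  have h := phi_sq
  rw [h4, ← two_mul_psi] at h
  refine h.trans ?_
  simp only [map_mul, map_pow, map_ofNat]
  ring

lemma coeff_two_mul_add_one (A B : ℤ⟦X⟧) (n : ℕ) :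
    coeff (2 * n + 1) (expand 2 two_ne_zero A + X * expand 2 two_ne_zero B) = coeff n B := by
  rw [map_add, coeff_succ_X_mul, coeff_expand_mul, coeff_expand_of_not_dvd, zero_add]
  lia

/-- The identity `1 / φ(-q)² = φ(q)² / φ(-q²)⁴`. -/
lemma overGenFun_sq : overGenFun ^ 2 = phi ^ 2 * expand 2 two_ne_zero (overGenFun ^ 4) := by
  have h1 := phiNeg_mul_overGenFun
  have h2 : expand 2 two_ne_zero (phiNeg ^ 4) * expand 2 two_ne_zero (overGenFun ^ 4) = 1 := by
    rw [← map_mul, ← mul_pow, h1, one_pow, map_one]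
  have h3 : phi = expand 2 two_ne_zero (phiNeg ^ 2) * overGenFun := by
    rw [← phi_mul_phiNeg, mul_assoc, h1, mul_one]
  have h4 : expand 2 two_ne_zero (phiNeg ^ 4) = expand 2 two_ne_zero (phiNeg ^ 2) ^ 2 := by
    rw [← map_pow]; congr 1; ring
  rw [h4] at h2
  rw [h3]
  linear_combination -overGenFun ^ 2 * h2

/-- The 2-dissection of the generating function of overpartition pairs. -/
lemma overGenFun_sq_dissection : overGenFun ^ 2 =
    expand 2 two_ne_zero (phi ^ 2 * overGenFun ^ 4) +
      X * expand 2 two_ne_zero (4 * (expand 2 two_ne_zero (psi ^ 2) * overGenFun ^ 4)) := by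
  conv_lhs => rw [overGenFun_sq, phi_sq_eq]
  simp only [map_mul, map_ofNat]
  ring

/-- The odd part of `1 / φ(-q)⁴` is `8 q ψ(q²)⁴ / φ(-q²)⁸`. -/
lemma overGenFun_pow_four_dissection : overGenFun ^ 4 =
    expand 2 two_ne_zero ((phi ^ 2 * overGenFun ^ 4) ^ 2 +
      X * (4 * (expand 2 two_ne_zero (psi ^ 2) * overGenFun ^ 4)) ^ 2) +
      X * expand 2 two_ne_zero (8 * (psi ^ 4 * overGenFun ^ 8)) := by
  have h : psi ^ 4 = phi ^ 2 * expand 2 two_ne_zero psi ^ 2 := by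
    rw [← mul_pow, ← psi_sq]; ring
  rw [show overGenFun ^ 4 = (overGenFun ^ 2) ^ 2 by ring]
  conv_lhs => rw [overGenFun_sq_dissection]
  rw [h]
  simp only [map_add, map_mul, map_pow, map_ofNat, expand_X]
  ring

/-- The number of overpartition pairs of `4 n + 3` is `32` times the coefficient of `q^n` in
`ψ(q)^6 / φ(-q)^8`. -/
lemma numOverpartitionPairs_four_mul_add_three (n : ℕ) :
    (numOverpartitionPairs (4 * n + 3) : ℤ) = 32 * coeff n (psi ^ 6 * overGenFun ^ 8) := by
  have h (A B : ℤ⟦X⟧) : 4 * (expand 2 two_ne_zero (psi ^ 2) *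
      (expand 2 two_ne_zero A + X * expand 2 two_ne_zero (8 * (psi ^ 4 * overGenFun ^ 8)))) =
      expand 2 two_ne_zero (4 * psi ^ 2 * A) +
        X * expand 2 two_ne_zero (32 * (psi ^ 6 * overGenFun ^ 8)) := by
    simp only [map_mul, map_pow, map_ofNat]
    ring
  rw [numOverpartitionPairs_eq_coeff, overGenFun_sq_dissection,
    show 4 * n + 3 = 2 * (2 * n + 1) + 1 by ring, coeff_two_mul_add_one,
    overGenFun_pow_four_dissection, h _ 0, coeff_two_mul_add_one, ← map_ofNat C 32, coeff_C_mul]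

/-- In a `p`-th power only the exponents divisible by `p` survive modulo `p`, as its derivative
vanishes modulo `p`. -/
lemma prime_dvd_coeff_pow {p : ℕ} (hp : p.Prime) (g : ℤ⟦X⟧) {n : ℕ} (hn : ¬ p ∣ n) :
    (p : ℤ) ∣ coeff n (g ^ p) := by
  obtain _ | n := n
  · simp at hn
  have h := congrArg (coeff n) (derivative_pow (R := ℤ) g p)
  rw [coeff_derivative, mul_assoc, ← map_natCast C, coeff_C_mul] at h
  have h' : (p : ℤ) ∣ coeff (n + 1) (g ^ p) * ((n + 1 : ℕ) : ℤ) := by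
    push_cast
    exact ⟨_, h⟩
  exact ((Nat.prime_iff_prime_int.mp hp).dvd_mul.mp h').resolve_right
    fun h ↦ hn (Int.natCast_dvd_natCast.mp h)

/-- Triangular numbers are `0`, `1` or `3` modulo 5, and `j (j + 1) / 2 ≡ 3` only for
`j ≡ 2` modulo 5. -/
lemma five_dvd_weight {j : ℤ} {n : ℕ} (hj : triangular j = n)
    (hn : n % 5 = 2 ∨ n % 5 = 3 ∨ n % 5 = 4) : 5 ∣ 2 * j + 1 := by
  have h : 2 * (n : ℤ) = j * (j + 1) := by rw [← hj, two_mul_triangular]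
  have h5 : (j * (j + 1)) % 5 = 4 ∨ (j * (j + 1)) % 5 = 1 ∨ (j * (j + 1)) % 5 = 3 := by lia
  have hj5 : j % 5 = 0 ∨ j % 5 = 1 ∨ j % 5 = 2 ∨ j % 5 = 3 ∨ j % 5 = 4 := by lia
  rcases hj5 with hj5 | hj5 | hj5 | hj5 | hj5 <;> simp [Int.mul_emod, Int.add_emod, hj5] at h5
  lia

lemma five_dvd_coeff_euler_cube {n : ℕ} (hn : n % 5 = 2 ∨ n % 5 = 3 ∨ n % 5 = 4) :
    5 ∣ coeff n (euler 1 ^ 3) := by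
  have h := (WithPiTopology.hasSum_iff_hasSum_coeff _).mp
    (hasSum_theta (fun j ↦ j.negOnePow * (2 * j + 1)) growing_triangular) n
  rw [← two_mul_euler_cube, ← map_ofNat C 2, coeff_C_mul] at h
  have h5 : (5 : ℤ) ∣ 2 * coeff n (euler 1 ^ 3) := by
    rw [← Ideal.mem_span_singleton]
    refine (isClosed_discrete _).mem_of_tendsto h (Eventually.of_forall fun s ↦ ?_)
    refine Ideal.sum_mem _ fun j _ ↦ Ideal.mem_span_singleton.mpr ?_
    rw [coeff_monomial]
    split_ifs with hj
    · exact (five_dvd_weight hj.symm hn).mul_left _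
    · exact dvd_zero _
  lia

lemma five_dvd_coeff {n : ℕ} (hn : n % 5 = 2 ∨ n % 5 = 3 ∨ n % 5 = 4) :
    5 ∣ coeff n (psi ^ 6 * overGenFun ^ 8) := by
  have h : psi ^ 6 * overGenFun ^ 8 = (psi * overGenFun ^ 2) ^ 5 * euler 1 ^ 3 := by
    rw [← psi_mul_phiNeg_sq]
    linear_combination (-psi ^ 6 * overGenFun ^ 8 * (phiNeg * overGenFun + 1)) *
      phiNeg_mul_overGenFun
  rw [h, coeff_mul]
  refine Finset.dvd_sum fun x hx ↦ ?_
  rw [Finset.HasAntidiagonal.mem_antidiagonal] at hx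
  by_cases h5 : 5 ∣ x.1
  · exact (five_dvd_coeff_euler_cube (by lia)).mul_left _
  · exact (prime_dvd_coeff_pow Nat.prime_five _ h5).mul_right _

lemma five_dvd_numOverpartitionPairs {n : ℕ} (hn : n % 5 = 2 ∨ n % 5 = 3 ∨ n % 5 = 4) :
    numOverpartitionPairs (4 * n + 3) ≡ 0 [MOD 5] := by
  refine (Nat.modEq_zero_iff_dvd).mpr (Int.natCast_dvd_natCast.mp ?_)
  rw [numOverpartitionPairs_four_mul_add_three]
  exact (five_dvd_coeff hn).mul_left _

lemma sixtyfour_dvd_numOverpartitionPairs (n : ℕ) :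
    numOverpartitionPairs (8 * n + 7) ≡ 0 [MOD 64] := by
  refine (Nat.modEq_zero_iff_dvd).mpr (Int.natCast_dvd_natCast.mp ?_)
  rw [show 8 * n + 7 = 4 * (2 * n + 1) + 3 by ring, numOverpartitionPairs_four_mul_add_three,
    show psi ^ 6 * overGenFun ^ 8 = (psi ^ 3 * overGenFun ^ 4) ^ 2 by ring]
  exact mul_dvd_mul (a := (32 : ℤ)) (b := 32) (c := 2) dvd_rfl
    (prime_dvd_coeff_pow Nat.prime_two _ (by lia))

end OverpartitionCongruence

theorem mainTheorem2 (n : ℕ) :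
    numOverpartitionPairs (8 * n + 7) ≡ 0 [MOD 64] ∧
    numOverpartitionPairs (20 * n + 11) ≡ 0 [MOD 5] ∧
    numOverpartitionPairs (20 * n + 15) ≡ 0 [MOD 5] ∧
    numOverpartitionPairs (20 * n + 19) ≡ 0 [MOD 5] := by
  refine ⟨OverpartitionCongruence.sixtyfour_dvd_numOverpartitionPairs n, ?_, ?_, ?_⟩
  · rw [show 20 * n + 11 = 4 * (5 * n + 2) + 3 by ring]
    exact OverpartitionCongruence.five_dvd_numOverpartitionPairs (by lia)
  · rw [show 20 * n + 15 = 4 * (5 * n + 3) + 3 by ring]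
    exact OverpartitionCongruence.five_dvd_numOverpartitionPairs (by lia)
  · rw [show 20 * n + 19 = 4 * (5 * n + 4) + 3 by ring]
    exact OverpartitionCongruence.five_dvd_numOverpartitionPairs (by lia)
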